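/- Let $x_1,\dots,x_n\in\mathbb R^d$ ($n\ge 1$) and $y_1,\dots,y_n\in\{-1,+1\}$ be linearly separable, i.e. $y_i\,w^\top x_i>0$ for all $i$, for some $w\in\mathbb R^d$ (a bias is included by appending a constant coordinate to the data). Let $\mathcal L(w)=\frac1n\sum_{i=1}^n\exp(-y_i w^\top x_i)$. For a norm $\|\cdot\|$ on $\mathbb R^d$ let $\|\delta\|_*=\sup\{|\langle\delta,v\rangle| : \|v\|\le 1\}$ be its dual norm. Let $$\rho(w)=\sup\{\varepsilon\in\mathbb R : y_i\,w^\top(x_i+\delta)>0\ \text{ for all } i \text{ and all }\delta\text{ with }\|\delta\|_*\le\varepsilon\};$$ $w$ is called a maximally robust classifier against perturbations bounded in $\|\cdot\|_*$ if $\rho(w)=\max_{w'}\rho(w')$. Let $w_0\in\mathbb R^d$ be arbitrary and let $w_{t+1}=w_t+\gamma_t\Delta_t$ with $\Delta_t\in\arg\min_v\ \langle\nabla\mathcal L(w_t),v\rangle+\frac12\|v\|^2$ be steepest descent iterates with respect to $\|\cdot\|$, where the step sizes are positive and bounded and satisfy $\gamma_t\le 1/(B^2\mathcal L(w_t))$ with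 $B=\max_i\|x_i\|_*$, and $\sum_t\gamma_t=\infty$ (for instance, a constant step size satisfying the upper bound). Then the iterates converge in direction to maximal robustness, in the following sense. 1. The maximum of $\rho$ exists and is positive, and $\rho(w_t)\to\max_w\rho(w)$. 2. The set $S$ of maximally robust classifiers $v$ with $\|v\|=1$ is nonempty, and the distance of $w_t/\|w_t\|$ to $S$ tends to $0$. Every limit of $w_t/\|w_t\|$, also along a subsequence, belongs to $S$. 3. If $S$ consists of a single vector $v$, then $w_t/\|w_t\|\to v$. In particular, with the same conditions on the step sizes (for the respective dual norm): * sign gradient descent, $w_{t+1}=w_t-\gamma_t\|\nabla\mathcal L(w_t)\|_1\,\mathrm{sign}(\nabla\mathcal L(w_t))$, satisfies 1–3 with $\|\cdot\|=\|\cdot\|_\infty$ and perturbations bounded in $\ell_1$; * gradient descent, $w_{t+1}=w_t-\gamma_t\nabla\mathcal L(w_t)$, satisfies 1–3 with $\|\cdot\|=\|\cdot\|_2$ and perturbations bounded in $\ell_2$, and $w_t/\|w_t\|_2$ converges to a maximally robust classifier; * coordinate descent, $w_{t+1}=w_t-\gamma_t\,\nabla\mathcal L(w_t)_{i}\,e_{i}$,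 where $i=i_t$ is a coordinate in which $\nabla\mathcal L(w_t)$ is largest in absolute value, satisfies 1–3 with $\|\cdot\|=\|\cdot\|_1$ and perturbations bounded in $\ell_\infty$. -/

import Mathlib

open Filter Topology

noncomputable section

namespace ImplicitBias

/-- The space `ℝ^d` with its standard inner product. Its Euclidean norm is used only for the
inner product, the gradient and the topology; the norms of the optimizer and of the attack are
separate functions `ℝ^d → ℝ`. -/
abbrev Vec (d : ℕ) : Type := EuclideanSpace ℝ (Fin d)

/-- The `ℓ_p` norm on `ℝ^d`. -/
def ellNorm {d : ℕ} (p : ENNReal) (v : Vec d) : ℝ :=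
  ‖(WithLp.toLp p (WithLp.ofLp v) : PiLp p (fun _ : Fin d => ℝ))‖

/-- The dual norm `‖δ‖_* = sup { |⟨δ, v⟩| : ‖v‖ ≤ 1 }` of a norm `N`. -/
def dualNorm {d : ℕ} (N : Vec d → ℝ) (δ : Vec d) : ℝ :=
  sSup {r : ℝ | ∃ v : Vec d, N v ≤ 1 ∧ r = |inner ℝ δ v|}

/-- Linear separability (through the origin). -/
def Separable {n d : ℕ} (x : Fin n → Vec d) (y : Fin n → ℝ) : Prop :=
  ∃ w : Vec d, ∀ i, 0 < y i * inner ℝ w (x i)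

/-- The empirical risk of the linear model `w` with the exponential loss. -/
def risk {n d : ℕ} (x : Fin n → Vec d) (y : Fin n → ℝ) (w : Vec d) : ℝ :=
  (1 / (n : ℝ)) * ∑ i, Real.exp (-(y i * inner ℝ w (x i)))

/-- `w` classifies every data point correctly under all perturbations `δ` with `‖δ‖ ≤ ε`, where
`P` is the norm that bounds the perturbations. -/
def RobustAt {n d : ℕ} (P : Vec d → ℝ) (x : Fin n → Vec d) (y : Fin n → ℝ)
    (w : Vec d) (ε : ℝ) : Prop :=
  ∀ i, ∀ δ : Vec d, P δ ≤ ε → 0 < y i * inner ℝ w (x i + δ)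

/-- The set of the `ε` is bounded above, so the supremum below is a genuine one. -/
theorem bddAbove_robustAt {n d : ℕ} (hn : 0 < n) (P : Vec d → ℝ) (x : Fin n → Vec d)
    (y : Fin n → ℝ) (w : Vec d) : BddAbove {ε : ℝ | RobustAt P x y w ε} := by
  refine ⟨P (-x ⟨0, hn⟩), fun ε hε => ?_⟩
  by_contra h
  have := hε ⟨0, hn⟩ (-x ⟨0, hn⟩) (not_le.mp h).le
  simp at this

/-- The set of the `ε` is nonempty: negative `ε` belong to it vacuously. -/
theorem nonempty_robustAt {n d : ℕ} (P : Vec d → ℝ) (hP : ∀ v, 0 ≤ P v) (x : Fin n → Vec d)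
    (y : Fin n → ℝ) (w : Vec d) : {ε : ℝ | RobustAt P x y w ε}.Nonempty :=
  ⟨-1, fun _ δ h => absurd h (by have := hP δ; linarith)⟩

/-- The largest (supremal) size `ε` of perturbations to which `w` is robust. It is `0` for a `w`
that does not classify the data correctly. -/
def robustness {n d : ℕ} (P : Vec d → ℝ) (x : Fin n → Vec d) (y : Fin n → ℝ)
    (w : Vec d) : ℝ :=
  sSup {ε : ℝ | RobustAt P x y w ε}

/-- `w` is a maximally robust linear classifier against perturbations bounded in the norm `P`. -/
def MaximallyRobust {n d : ℕ} (P : Vec d → ℝ) (x : Fin n → Vec d) (y : Fin n → ℝ)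
    (w : Vec d) : Prop :=
  ∀ w' : Vec d, robustness P x y w' ≤ robustness P x y w

/-- A steepest descent step for `f` at `w`: a minimizer of `⟨∇f(w), v⟩ + ‖v‖² / 2`. -/
def IsSteepestStep {d : ℕ} (N : Vec d → ℝ) (f : Vec d → ℝ) (w Δ : Vec d) : Prop :=
  ∀ v : Vec d, inner ℝ (gradient f w) Δ + 1 / 2 * N Δ ^ 2
    ≤ inner ℝ (gradient f w) v + 1 / 2 * N v ^ 2

/-- Steepest descent with respect to the norm `N`. -/
def IsSteepestDescent {d : ℕ} (N : Vec d → ℝ) (f : Vec d → ℝ) (γ : ℕ → ℝ)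
    (w : ℕ → Vec d) : Prop :=
  ∀ t, ∃ Δ : Vec d, IsSteepestStep N f (w t) Δ ∧ w (t + 1) = w t + γ t • Δ

/-- Gradient descent. -/
def IsGradientDescent {d : ℕ} (f : Vec d → ℝ) (γ : ℕ → ℝ) (w : ℕ → Vec d) : Prop :=
  ∀ t, w (t + 1) = w t - γ t • gradient f (w t)

/-- Sign gradient descent, with steps `-‖∇f(w)‖₁ sign(∇f(w))`. -/
def IsSignGradientDescent {d : ℕ} (f : Vec d → ℝ) (γ : ℕ → ℝ) (w : ℕ → Vec d) : Prop :=
  ∀ t, w (t + 1) = w t - (γ t * ellNorm 1 (gradient f (w t))) •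
    (WithLp.toLp 2 (fun j => Real.sign (gradient f (w t) j)) : Vec d)

/-- Coordinate descent, along a coordinate in which the gradient is largest in absolute value. -/
def IsCoordinateDescent {d : ℕ} (f : Vec d → ℝ) (γ : ℕ → ℝ) (w : ℕ → Vec d) : Prop :=
  ∀ t, ∃ i : Fin d, (∀ j, |gradient f (w t) j| ≤ |gradient f (w t) i|) ∧
    w (t + 1) = w t - (γ t * gradient f (w t) i) • EuclideanSpace.single i (1 : ℝ)

/-- The conditions on the step sizes: they are positive, bounded, at most `1 / (B² L(w_t))` with
`B = max_i ‖x_i‖_*`, and their sum diverges. `P` is the dual of the norm of the optimizer. -/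
structure AdmissibleSteps {n d : ℕ} (P : Vec d → ℝ) (x : Fin n → Vec d) (y : Fin n → ℝ)
    (γ : ℕ → ℝ) (w : ℕ → Vec d) : Prop where
  pos : ∀ t, 0 < γ t
  bounded : ∃ γmax : ℝ, ∀ t, γ t ≤ γmax
  le : ∀ t, γ t ≤ 1 / ((⨆ i, P (x i)) ^ 2 * risk x y (w t))
  sum_diverges : Tendsto (fun T => ∑ t ∈ Finset.range T, γ t) atTop atTop

/-- The direction `w / ‖w‖`. -/
def direction {d : ℕ} (N : Vec d → ℝ) (w : Vec d) : Vec d := (N w)⁻¹ • w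

/-- The sequence `w` converges in direction to `v`. -/
def ConvergesInDirection {d : ℕ} (N : Vec d → ℝ) (w : ℕ → Vec d) (v : Vec d) : Prop :=
  Tendsto (fun t => direction N (w t)) atTop (𝓝 v)

/-- The maximally robust classifiers (against perturbations bounded in `P`) that are normalized
with respect to `N`. -/
def maxRobustDirections {n d : ℕ} (N P : Vec d → ℝ) (x : Fin n → Vec d) (y : Fin n → ℝ) :
    Set (Vec d) :=
  {v | N v = 1 ∧ MaximallyRobust P x y v}

/-- Convergence in direction to maximal robustness: the maximal robustness is positive and
attained, and the robustness of `w t` tends to it; the directions of `w t` approach the set of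
maximally robust directions; every limit of them, also along a subsequence, is a maximally robust
classifier; and if there is only one maximally robust direction, they converge to it. -/
structure ReachesMaxRobust {n d : ℕ} (N P : Vec d → ℝ) (x : Fin n → Vec d) (y : Fin n → ℝ)
    (w : ℕ → Vec d) : Prop where
  robustness_tendsto : ∃ ε : ℝ, 0 < ε ∧ IsGreatest (Set.range (robustness P x y)) ε ∧
    Tendsto (fun t => robustness P x y (w t)) atTop (𝓝 ε)
  nonempty : (maxRobustDirections N P x y).Nonempty
  dist_tendsto : Tendsto
    (fun t => Metric.infDist (direction N (w t)) (maxRobustDirections N P x y)) atTop (𝓝 0)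
  limit : ∀ (φ : ℕ → ℕ) (v : Vec d), StrictMono φ → ConvergesInDirection N (w ∘ φ) v →
    v ∈ maxRobustDirections N P x y
  unique : ∀ v, maxRobustDirections N P x y = {v} → ConvergesInDirection N w v

end ImplicitBias

end

open ImplicitBias

/-!
By Hahn–Banach a norm `N` is the dual of its dual norm, so the worst perturbation of size `ε` lowers
the margin `min_i y_i ⟨w, x_i⟩` by exactly `ε * N w`. Hence the robustness of `w` is its normalized
margin (`robustness_eq`), and the maximally robust unit vectors are the maximizers of the margin on
the unit sphere of `N`; let `m > 0` be the maximum. By compactness of the sphere it suffices that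
the normalized margin of the iterates tends to `m` (`reachesMaxRobust_of_tendsto`).

Two facts about the risk `L` and `D_t = ‖∇L(w_t)‖_*` give this. A maximizer of the margin shows that
`D_t ≥ m L(w_t)` (`margin_mul_risk_le_dualNorm`). Moreover the curvature of `L` is at most `B²` times
`L` itself, so with `γ_t ≤ 1 / (B² L(w_t))` a steepest descent step lowers `L` by at least
`γ_t D_t² / 4`, and lowers `log L` by at least `γ_t D_t² / L(w_t) ≥ m γ_t D_t` up to an error of
order `γ_t² D_t²`. The step sizes being bounded, this error is at most a constant times the decrease
of `L`, and telescopes (`log_risk_step_le`). With `G_T = ∑_{t < T} γ_t D_t`, the margin of `w_T` is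
therefore at least `m G_T - C`, while `N (w_T) ≤ N (w_0) + G_T`. Finally `G_T → ∞`: otherwise the
iterates stay in a bounded set, where `D_t ≥ m L(w_t)` is bounded away from zero, against
`∑ γ_t = ∞`. So the quotient tends to `m` (`tendsto_normalized_margin`).

Sign gradient descent, gradient descent and coordinate descent take steepest descent steps for the
norms of index `∞`, `2` and `1`. In the Euclidean case strict convexity makes the maximizer unique,
which yields convergence in direction.
-/

namespace ImplicitBias

/-! ### Norms on `ℝ^d` and their duals -/

section Norms

variable {d : ℕ} (N : Seminorm ℝ (Vec d))

theorem continuous_seminorm : Continuous N :=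
  continuousOn_univ.1 (N.convexOn.continuousOn isOpen_univ)

theorem exists_pos_mul_norm_le (hN : ∀ v, N v = 0 → v = 0) :
    ∃ c : ℝ, 0 < c ∧ ∀ v, c * ‖v‖ ≤ N v := by
  rcases (Metric.sphere (0 : Vec d) 1).eq_empty_or_nonempty with h | h
  · refine ⟨1, one_pos, fun v => ?_⟩
    by_cases hv : v = 0
    · simp [hv]
    · have : (‖v‖⁻¹ • v) ∈ Metric.sphere (0 : Vec d) 1 := by
        simp [norm_smul, inv_mul_cancel₀ (norm_ne_zero_iff.2 hv)]
      simp [h] at this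
  · obtain ⟨u, hu, hmin⟩ := (isCompact_sphere (0 : Vec d) 1).exists_isMinOn h
      (continuous_seminorm N).continuousOn
    have hu1 : ‖u‖ = 1 := by simpa using hu
    refine ⟨N u, lt_of_le_of_ne (apply_nonneg N u) fun h0 => ?_, fun v => ?_⟩
    · simp [hN u h0.symm] at hu1
    · by_cases hv : v = 0
      · simp [hv]
      · have hv' : 0 < ‖v‖ := norm_pos_iff.2 hv
        have hmem : (‖v‖⁻¹ • v) ∈ Metric.sphere (0 : Vec d) 1 := by
          simp [norm_smul, inv_mul_cancel₀ hv'.ne']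
        have := isMinOn_iff.1 hmin _ hmem
        rw [map_smul_eq_mul, norm_inv, norm_norm, inv_mul_eq_div, le_div_iff₀ hv'] at this
        exact this

theorem isCompact_unitSphere (hN : ∀ v, N v = 0 → v = 0) : IsCompact {v : Vec d | N v = 1} := by
  obtain ⟨c, hc, hcN⟩ := exists_pos_mul_norm_le N hN
  refine Metric.isCompact_of_isClosed_isBounded
    (isClosed_eq (continuous_seminorm N) continuous_const)
    (isBounded_iff_forall_norm_le.2 ⟨1 / c, fun v hv => ?_⟩)
  rw [le_div_iff₀ hc, mul_comm]
  exact (hcN v).trans hv.le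

/-- The set in the definition of the dual norm is bounded, so its supremum is a genuine one. -/
theorem bddAbove_dualNorm (hN : ∀ v, N v = 0 → v = 0) (δ : Vec d) :
    BddAbove {r : ℝ | ∃ v : Vec d, N v ≤ 1 ∧ r = |inner ℝ δ v|} := by
  obtain ⟨c, hc, hcN⟩ := exists_pos_mul_norm_le N hN
  refine ⟨‖δ‖ * (1 / c), ?_⟩
  rintro r ⟨v, hv, rfl⟩
  refine (abs_real_inner_le_norm δ v).trans (mul_le_mul_of_nonneg_left ?_ (norm_nonneg δ))
  rw [le_div_iff₀ hc, mul_comm]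
  exact (hcN v).trans hv

theorem dualNorm_nonneg (N : Vec d → ℝ) (δ : Vec d) : 0 ≤ dualNorm N δ := by
  refine Real.sSup_nonneg ?_
  rintro r ⟨v, -, rfl⟩
  exact abs_nonneg _

theorem dualNorm_le {δ : Vec d} {a : ℝ} (h : ∀ v, N v ≤ 1 → |inner ℝ δ v| ≤ a) :
    dualNorm N δ ≤ a := by
  refine csSup_le ⟨_, 0, by simp, rfl⟩ ?_
  rintro r ⟨v, hv, rfl⟩
  exact h v hv

theorem abs_inner_le_dualNorm_mul (hN : ∀ v, N v = 0 → v = 0) (δ v : Vec d) :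
    |inner ℝ δ v| ≤ dualNorm N δ * N v := by
  by_cases hv : v = 0
  · simp [hv]
  · have hpos : 0 < N v := lt_of_le_of_ne (apply_nonneg N v) fun h => hv (hN v h.symm)
    have h := le_csSup (bddAbove_dualNorm N hN δ)
      ⟨(N v)⁻¹ • v, by simp [map_smul_eq_mul, abs_of_pos hpos, inv_mul_cancel₀ hpos.ne'], rfl⟩
    rw [inner_smul_right, abs_mul, abs_inv, abs_of_pos hpos, inv_mul_eq_div,
      div_le_iff₀ hpos] at h
    exact h

/-- Every vector has a norming functional (Hahn–Banach). In other words, the dual of the dual norm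
is the norm itself. -/
theorem exists_dualNorm_le_one_inner_eq (w : Vec d) :
    ∃ δ : Vec d, dualNorm N δ ≤ 1 ∧ inner ℝ δ w = N w := by
  by_cases hw : w = 0
  · exact ⟨0, dualNorm_le N fun v _ => by simp, by simp [hw]⟩
  obtain ⟨g, hg, hgN⟩ := exists_extension_of_le_sublinear
    (LinearPMap.mkSpanSingleton w (N w) hw) N
    (fun c hc v => by rw [map_smul_eq_mul, Real.norm_of_nonneg hc.le])
    (fun u v => map_add_le_add N u v) (by
      rintro ⟨v, hv⟩
      obtain ⟨c, rfl⟩ := Submodule.mem_span_singleton.1 hv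
      rw [LinearPMap.mkSpanSingleton'_apply]
      simp only [map_smul_eq_mul, smul_eq_mul, Real.norm_eq_abs]
      exact mul_le_mul_of_nonneg_right (le_abs_self c) (apply_nonneg N w))
  have hgw : g w = N w := by
    have h := hg ⟨w, Submodule.mem_span_singleton_self w⟩
    exact h.trans (LinearPMap.mkSpanSingleton_apply ℝ ℝ hw (N w))
  have hin : ∀ v, inner ℝ ((InnerProductSpace.toDual ℝ (Vec d)).symm
      (LinearMap.toContinuousLinearMap g)) v = g v := fun v => by simp
  refine ⟨_, dualNorm_le N fun v hv => ?_, (hin w).trans hgw⟩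
  rw [hin, abs_le]
  have h1 := hgN v
  have h2 := hgN (-v)
  rw [map_neg, map_neg_eq_map] at h2
  constructor <;> linarith

/-- A steepest descent step has the length `‖∇f(w)‖_*` and makes the inner product with the
gradient as small as this length permits. -/
theorem IsSteepestStep.norm_eq_and_inner_le (hN : ∀ v, N v = 0 → v = 0) {f : Vec d → ℝ}
    {w Δ : Vec d} (h : IsSteepestStep N f w Δ) :
    N Δ = dualNorm N (gradient f w) ∧
      inner ℝ (gradient f w) Δ ≤ -dualNorm N (gradient f w) ^ 2 := by
  set g := gradient f w with hg
  set D := dualNorm N g with hD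
  have hval : D ^ 2 ≤ -2 * (inner ℝ g Δ + 1 / 2 * N Δ ^ 2) := by
    have hle : D ≤ √(-2 * (inner ℝ g Δ + 1 / 2 * N Δ ^ 2)) := by
      refine dualNorm_le N fun v hv => Real.le_sqrt_of_sq_le ?_
      have h1 := h ((-inner ℝ g v) • v)
      rw [← hg, inner_smul_right, map_smul_eq_mul, norm_neg, Real.norm_eq_abs, mul_pow,
        sq_abs] at h1
      have h2 : N v ^ 2 ≤ 1 := pow_le_one₀ (apply_nonneg N v) hv
      have h3 := mul_le_mul_of_nonneg_left h2 (sq_nonneg (inner ℝ g v))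
      rw [sq_abs]
      nlinarith
    have h0 : 0 ≤ -2 * (inner ℝ g Δ + 1 / 2 * N Δ ^ 2) := by
      have := h 0
      simp only [inner_zero_right, map_zero] at this
      linarith
    calc D ^ 2 ≤ √(-2 * (inner ℝ g Δ + 1 / 2 * N Δ ^ 2)) ^ 2 :=
          pow_le_pow_left₀ (dualNorm_nonneg _ g) hle 2
      _ = _ := Real.sq_sqrt h0
  have hin := (abs_le.1 (abs_inner_le_dualNorm_mul N hN g Δ)).1
  rw [← hD] at hin
  have hsq : (N Δ - D) ^ 2 = 0 := le_antisymm (by nlinarith) (sq_nonneg _)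
  have heq : N Δ = D := sub_eq_zero.1 (pow_eq_zero_iff two_ne_zero |>.1 hsq)
  refine ⟨heq, ?_⟩
  rw [heq] at hval
  linarith

/-- A sufficient condition for a steepest descent step. -/
theorem isSteepestStep_of_inner_eq (hN : ∀ v, N v = 0 → v = 0) {f : Vec d → ℝ} {w Δ : Vec d}
    (hle : N Δ ≤ dualNorm N (gradient f w))
    (hin : inner ℝ (gradient f w) Δ = -dualNorm N (gradient f w) ^ 2) :
    IsSteepestStep N f w Δ := by
  intro v
  have h1 := (abs_le.1 (abs_inner_le_dualNorm_mul N hN (gradient f w) v)).1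
  have h2 := pow_le_pow_left₀ (apply_nonneg N Δ) hle 2
  rw [hin]
  nlinarith [sq_nonneg (dualNorm N (gradient f w) - N v)]

/-- The dual norm is pinned down by a Hölder inequality in which equality occurs. -/
theorem dualNorm_eq_of_inner_eq {δ v : Vec d} {a : ℝ}
    (h : ∀ u, |inner ℝ δ u| ≤ a * N u) (ha : 0 ≤ a) (hv : N v ≤ 1) (hav : inner ℝ δ v = a) :
    dualNorm N δ = a := by
  have hb : ∀ u, N u ≤ 1 → |inner ℝ δ u| ≤ a := fun u hu =>
    (h u).trans (mul_le_of_le_one_right ha hu)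
  refine le_antisymm (dualNorm_le N hb) (le_csSup ⟨a, ?_⟩ ⟨v, hv, by rw [hav, abs_of_nonneg ha]⟩)
  rintro r ⟨u, hu, rfl⟩
  exact hb u hu

end Norms

/-! ### The margin and the robustness -/

section Margin

variable {n d : ℕ} (x : Fin n → Vec d) (y : Fin n → ℝ)

/-- The margin `min_i y_i ⟨w, x_i⟩` of a linear classifier, unnormalized. -/
noncomputable def margin (w : Vec d) : ℝ := ⨅ i, y i * inner ℝ w (x i)

theorem margin_le (w : Vec d) (i : Fin n) : margin x y w ≤ y i * inner ℝ w (x i) :=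
  ciInf_le (Set.finite_range _).bddBelow i

theorem le_margin [Nonempty (Fin n)] {w : Vec d} {a : ℝ}
    (h : ∀ i, a ≤ y i * inner ℝ w (x i)) : a ≤ margin x y w :=
  le_ciInf h

theorem exists_eq_margin [Nonempty (Fin n)] (w : Vec d) :
    ∃ i, y i * inner ℝ w (x i) = margin x y w :=
  exists_eq_ciInf_of_finite

theorem continuous_margin [Nonempty (Fin n)] : Continuous (margin x y) := by
  have : margin x y = fun w => Finset.univ.inf' Finset.univ_nonempty
      fun i => y i * inner ℝ w (x i) := by
    funext w
    exact (Finset.inf'_univ_eq_ciInf _).symm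
  rw [this]
  exact Continuous.finset_inf'_apply _ fun i _ => by fun_prop

theorem margin_smul [Nonempty (Fin n)] {c : ℝ} (hc : 0 ≤ c) (w : Vec d) :
    margin x y (c • w) = c * margin x y w := by
  simp only [margin, inner_smul_left, RCLike.conj_to_real, mul_left_comm, Real.mul_iInf_of_nonneg hc]

theorem margin_zero [Nonempty (Fin n)] : margin x y 0 = 0 := by
  simpa using margin_smul x y le_rfl 0

theorem add_margin_le [Nonempty (Fin n)] (u v : Vec d) :
    margin x y u + margin x y v ≤ margin x y (u + v) := by
  refine le_margin x y fun i => ?_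
  rw [inner_add_left, mul_add]
  exact add_le_add (margin_le x y u i) (margin_le x y v i)

theorem robustAt_iff [Nonempty (Fin n)] (hy : ∀ i, y i = 1 ∨ y i = -1)
    (N : Seminorm ℝ (Vec d)) (hN : ∀ v, N v = 0 → v = 0) (w : Vec d) {ε : ℝ} (hε : 0 ≤ ε) :
    RobustAt (dualNorm N) x y w ε ↔ ε * N w < margin x y w := by
  constructor
  · intro h
    obtain ⟨i, hi⟩ := exists_eq_margin x y w
    obtain ⟨δ, hδ, hδw⟩ := exists_dualNorm_le_one_inner_eq N w
    -- the worst perturbation of the data point with the smallest margin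
    have hP : dualNorm N (-(y i * ε) • δ) ≤ ε := by
      refine dualNorm_le N fun v hv => ?_
      have hb : |inner ℝ δ v| ≤ 1 :=
        (abs_inner_le_dualNorm_mul N hN δ v).trans
          (mul_le_one₀ hδ (apply_nonneg N v) hv)
      rw [inner_smul_left, RCLike.conj_to_real, abs_mul, abs_neg, abs_mul, abs_of_nonneg hε]
      rcases hy i with h1 | h1 <;> simp only [h1, abs_neg, abs_one, one_mul] <;>
        exact mul_le_of_le_one_right hε hb
    have := h i _ hP
    rw [inner_add_right, inner_smul_right, real_inner_comm, mul_add, real_inner_comm,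
      real_inner_comm δ w, hδw, hi] at this
    rcases hy i with h1 | h1 <;> rw [h1] at this <;> linarith
  · intro h i δ hδ
    have h1 := margin_le x y w i
    have h2 : |inner ℝ w δ| ≤ ε * N w := by
      rw [real_inner_comm]
      exact (abs_inner_le_dualNorm_mul N hN δ w).trans
        (mul_le_mul_of_nonneg_right hδ (apply_nonneg N w))
    have h3 := abs_le.1 h2
    rw [inner_add_right, mul_add]
    rcases hy i with h4 | h4 <;> rw [h4] at h1 ⊢ <;> linarith [h3.1, h3.2]

/-- The robustness to attacks bounded in the dual norm is the normalized margin, except that it is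
`0` where the latter is negative. -/
theorem robustness_eq [Nonempty (Fin n)] (hy : ∀ i, y i = 1 ∨ y i = -1)
    (N : Seminorm ℝ (Vec d)) (hN : ∀ v, N v = 0 → v = 0) (w : Vec d) :
    robustness (dualNorm N) x y w = max (margin x y w / N w) 0 := by
  have hset : {ε : ℝ | RobustAt (dualNorm N) x y w ε} = Set.Iio (max (margin x y w / N w) 0) := by
    ext ε
    rw [Set.mem_ofPred_eq, Set.mem_Iio, lt_max_iff]
    rcases lt_or_ge ε 0 with hε | hε
    · exact iff_of_true (fun i δ h => absurd (h.trans_lt hε) (dualNorm_nonneg _ δ).not_gt)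
        (Or.inr hε)
    · rw [robustAt_iff x y hy N hN w hε, or_iff_left hε.not_gt]
      by_cases hw : w = 0
      -- for `w = 0` both sides fail, the quotient being `0 / 0 = 0`
      · simp [hw, margin_zero, hε]
      · rw [lt_div_iff₀ (lt_of_le_of_ne (apply_nonneg N w) fun h => hw (hN w h.symm))]
  rw [robustness, hset, csSup_Iio]

/-- There is a unit vector of maximal margin, and this margin is positive. -/
theorem exists_max_margin [Nonempty (Fin n)] (hsep : Separable x y)
    (N : Seminorm ℝ (Vec d)) (hN : ∀ v, N v = 0 → v = 0) :
    ∃ v, N v = 1 ∧ 0 < margin x y v ∧ ∀ w, margin x y w ≤ margin x y v * N w := by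
  obtain ⟨u, hu⟩ := hsep
  have hmu : 0 < margin x y u := by
    obtain ⟨i, hi⟩ := exists_eq_margin x y u
    exact hi ▸ hu i
  have hnorm : ∀ w : Vec d, w ≠ 0 → 0 < N w ∧ N ((N w)⁻¹ • w) = 1 := fun w hw => by
    have hpos := lt_of_le_of_ne (apply_nonneg N w) fun h => hw (hN w h.symm)
    exact ⟨hpos, by rw [map_smul_eq_mul, Real.norm_of_nonneg (inv_nonneg.2 hpos.le),
      inv_mul_cancel₀ hpos.ne']⟩
  have hu0 : u ≠ 0 := fun h => by simp [h, margin_zero] at hmu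
  obtain ⟨v, hv, hmax⟩ := (isCompact_unitSphere N hN).exists_isMaxOn
    ⟨_, (hnorm u hu0).2⟩ (continuous_margin x y).continuousOn
  have hle : ∀ w, margin x y w ≤ margin x y v * N w := fun w => by
    by_cases hw : w = 0
    · simp [hw, margin_zero]
    · obtain ⟨hpos, h1⟩ := hnorm w hw
      have := isMaxOn_iff.1 hmax _ h1
      rwa [margin_smul x y (inv_nonneg.2 hpos.le), inv_mul_eq_div, div_le_iff₀ hpos] at this
  exact ⟨v, hv, pos_of_mul_pos_left (hmu.trans_le (hle u)) (apply_nonneg N u), hle⟩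

end Margin

/-! ### Compactness: from the margin to the direction -/

section Direction

variable {n d : ℕ} [Nonempty (Fin n)] (x : Fin n → Vec d) (y : Fin n → ℝ)

theorem robustness_le
    (hy : ∀ i, y i = 1 ∨ y i = -1) (N : Seminorm ℝ (Vec d)) (hN : ∀ v, N v = 0 → v = 0)
    {v₀ : Vec d} (hpos : 0 < margin x y v₀)
    (hmax : ∀ w, margin x y w ≤ margin x y v₀ * N w) (w : Vec d) : robustness (dualNorm N) x y w ≤ margin x y v₀ := by
  rw [robustness_eq x y hy N hN]
  exact max_le (div_le_of_le_mul₀ (apply_nonneg N w) hpos.le (hmax w)) hpos.le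

theorem robustness_eq_margin
    (hy : ∀ i, y i = 1 ∨ y i = -1) (N : Seminorm ℝ (Vec d)) (hN : ∀ v, N v = 0 → v = 0)
    {v₀ : Vec d} (hv₀ : N v₀ = 1) (hpos : 0 < margin x y v₀) : robustness (dualNorm N) x y v₀ = margin x y v₀ := by
  rw [robustness_eq x y hy N hN, hv₀, div_one, max_eq_left hpos.le]

theorem maxRobustDirections_eq
    (hy : ∀ i, y i = 1 ∨ y i = -1) (N : Seminorm ℝ (Vec d)) (hN : ∀ v, N v = 0 → v = 0)
    {v₀ : Vec d} (hv₀ : N v₀ = 1) (hpos : 0 < margin x y v₀)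
    (hmax : ∀ w, margin x y w ≤ margin x y v₀ * N w) :
    maxRobustDirections N (dualNorm N) x y = {v | N v = 1 ∧ margin x y v = margin x y v₀} := by
  ext v
  refine and_congr_right fun hv => ⟨fun h => ?_, fun h w => ?_⟩
  · have h1 := h v₀
    rw [robustness_eq_margin x y hy N hN hv₀ hpos, robustness_eq x y hy N hN, hv, div_one,
      le_max_iff, or_iff_left hpos.not_ge] at h1
    have h2 := hmax v
    rw [hv, mul_one] at h2
    exact le_antisymm h2 h1
  · rw [robustness_eq x y hy N hN v, hv, div_one, h, max_eq_left hpos.le]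
    exact robustness_le x y hy N hN hpos hmax w

/-- Convergence of the normalized margin to its maximum implies everything else. -/
theorem reachesMaxRobust_of_tendsto
    (hy : ∀ i, y i = 1 ∨ y i = -1) (N : Seminorm ℝ (Vec d)) (hN : ∀ v, N v = 0 → v = 0)
    {v₀ : Vec d} (hv₀ : N v₀ = 1) (hpos : 0 < margin x y v₀)
    (hmax : ∀ w, margin x y w ≤ margin x y v₀ * N w)
    {w : ℕ → Vec d} (hw : ∀ᶠ t in atTop, 0 < N (w t))
    (hlim : Tendsto (fun t => margin x y (w t) / N (w t)) atTop (𝓝 (margin x y v₀))) :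
    ReachesMaxRobust N (dualNorm N) x y w := by
  have hS := maxRobustDirections_eq x y hy N hN hv₀ hpos hmax
  have hne : (maxRobustDirections N (dualNorm N) x y).Nonempty := by
    rw [hS]
    exact ⟨v₀, hv₀, rfl⟩
  have hdir1 : ∀ᶠ t in atTop, N (direction N (w t)) = 1 := by
    filter_upwards [hw] with t ht
    rw [direction, map_smul_eq_mul, Real.norm_of_nonneg (inv_nonneg.2 ht.le),
      inv_mul_cancel₀ ht.ne']
  have hdir : Tendsto (fun t => margin x y (direction N (w t))) atTop (𝓝 (margin x y v₀)) := by
    refine hlim.congr fun t => ?_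
    rw [direction, margin_smul x y (inv_nonneg.2 (apply_nonneg N _)), inv_mul_eq_div]
  have hdist : Tendsto (fun t => Metric.infDist (direction N (w t))
      (maxRobustDirections N (dualNorm N) x y)) atTop (𝓝 0) := by
    refine (nhds_basis_Ioo_pos (0 : ℝ)).tendsto_right_iff.2 fun ε hε => ?_
    -- on the unit vectors at distance at least `ε` from the set, the margin has a maximum
    -- below `margin x y v₀`
    have hK : IsCompact ({v : Vec d | N v = 1} ∩
        {v | ε ≤ Metric.infDist v (maxRobustDirections N (dualNorm N) x y)}) :=
      (isCompact_unitSphere N hN).inter_right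
        (isClosed_le continuous_const (Metric.continuous_infDist_pt _))
    have hfar : ∀ᶠ t in atTop, direction N (w t) ∉ ({v : Vec d | N v = 1} ∩
        {v | ε ≤ Metric.infDist v (maxRobustDirections N (dualNorm N) x y)}) := by
      rcases Set.eq_empty_or_nonempty ({v : Vec d | N v = 1} ∩
        {v | ε ≤ Metric.infDist v (maxRobustDirections N (dualNorm N) x y)}) with h | h
      · simp [h]
      · obtain ⟨u, ⟨hu1, huε⟩, humax⟩ := hK.exists_isMaxOn h (continuous_margin x y).continuousOn
        have hlt : margin x y u < margin x y v₀ := by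
          refine lt_of_le_of_ne ((hmax u).trans_eq (by rw [hu1, mul_one])) fun heq => ?_
          have hmem : u ∈ maxRobustDirections N (dualNorm N) x y := by
            rw [hS]
            exact ⟨hu1, heq⟩
          have : ε ≤ 0 := (Metric.infDist_zero_of_mem hmem) ▸ huε
          exact this.not_gt hε
        filter_upwards [hdir.eventually (lt_mem_nhds hlt)] with t ht hmem
        exact (isMaxOn_iff.1 humax _ hmem).not_gt ht
    filter_upwards [hdir1, hfar] with t h1 h2
    have h3 : ¬ ε ≤ Metric.infDist (direction N (w t))
        (maxRobustDirections N (dualNorm N) x y) := fun h => h2 ⟨h1, h⟩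
    refine ⟨?_, by linarith⟩
    have := Metric.infDist_nonneg (x := direction N (w t))
      (s := maxRobustDirections N (dualNorm N) x y)
    linarith
  refine ⟨⟨margin x y v₀, hpos, ⟨⟨v₀, robustness_eq_margin x y hy N hN hv₀ hpos⟩, ?_⟩, ?_⟩,
    hne, hdist, fun φ v hφ hv => ?_, fun v hv => ?_⟩
  · rintro _ ⟨u, rfl⟩
    exact robustness_le x y hy N hN hpos hmax u
  · have := hlim.max (tendsto_const_nhds (x := (0 : ℝ)))
    rw [max_eq_left hpos.le] at this
    exact this.congr fun t => (robustness_eq x y hy N hN (w t)).symm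
  · rw [hS]
    constructor
    · refine tendsto_nhds_unique (((continuous_seminorm N).tendsto v).comp hv)
        (tendsto_const_nhds.congr' ?_)
      filter_upwards [hφ.tendsto_atTop.eventually hdir1] with t ht
      exact ht.symm
    · exact tendsto_nhds_unique (((continuous_margin x y).tendsto v).comp hv)
        (hdir.comp hφ.tendsto_atTop)
  · rw [hv] at hdist
    simp only [Metric.infDist_singleton] at hdist
    exact tendsto_iff_dist_tendsto_zero.2 hdist

end Direction

/-! ### The exponential risk along a steepest descent step -/

section Risk

variable {n d : ℕ} (x : Fin n → Vec d) (y : Fin n → ℝ)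

theorem risk_pos [Nonempty (Fin n)] (w : Vec d) : 0 < risk x y w :=
  mul_pos (one_div_pos.2 (Nat.cast_pos.2 (Fin.pos_iff_nonempty.2 inferInstance)))
    (Finset.sum_pos (fun _ _ => Real.exp_pos _) Finset.univ_nonempty)

theorem continuous_risk : Continuous (risk x y) := by
  unfold risk
  fun_prop

theorem inner_gradient_risk (w v : Vec d) :
    inner ℝ (gradient (risk x y) w) v =
      -((1 / (n : ℝ)) * ∑ i, Real.exp (-(y i * inner ℝ w (x i))) * (y i * inner ℝ v (x i))) := by
  have hdiff : DifferentiableAt ℝ (risk x y) w :=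
    DifferentiableAt.const_mul (DifferentiableAt.fun_sum fun i _ =>
      ((differentiableAt_id.inner ℝ (differentiableAt_const (x i))).const_mul (y i)).neg.exp) _
  have h1 : HasDerivAt (fun s : ℝ => risk x y (w + s • v)) (fderiv ℝ (risk x y) w v) 0 :=
    hdiff.hasFDerivAt.hasLineDerivAt v
  have h2 : HasDerivAt (fun s : ℝ => risk x y (w + s • v))
      ((1 / (n : ℝ)) * ∑ i, Real.exp (-(y i * inner ℝ w (x i))) * (-(y i * inner ℝ v (x i)))) 0 := by
    refine HasDerivAt.const_mul _ (HasDerivAt.fun_sum fun i _ => ?_)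
    have h3 : HasDerivAt (fun s : ℝ => -(y i * inner ℝ (w + s • v) (x i)))
        (-(y i * inner ℝ v (x i))) 0 := by
      simp only [inner_add_left, inner_smul_left, RCLike.conj_to_real]
      have := ((((hasDerivAt_id (0 : ℝ)).mul_const (inner ℝ v (x i))).const_add
        (inner ℝ w (x i))).const_mul (y i)).fun_neg
      simpa using this
    simpa using h3.exp
  rw [gradient, InnerProductSpace.toDual_symm_apply, h1.unique h2, ← mul_neg,
    ← Finset.sum_neg_distrib]
  simp only [mul_neg]

theorem exp_neg_margin_le [Nonempty (Fin n)] (w : Vec d) :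
    Real.exp (-margin x y w) ≤ n * risk x y w := by
  have hn : (0 : ℝ) < n := Nat.cast_pos.2 (Fin.pos_iff_nonempty.2 inferInstance)
  obtain ⟨i, hi⟩ := exists_eq_margin x y w
  rw [risk, ← mul_assoc, mul_one_div_cancel hn.ne', one_mul, ← hi]
  exact Finset.single_le_sum (f := fun i => Real.exp (-(y i * inner ℝ w (x i))))
    (fun _ _ => (Real.exp_pos _).le) (Finset.mem_univ i)

/-- The constant has to be smaller than `1` for a step of the maximal size to decrease the risk. -/
theorem exp_le_one_add_add_sq {s : ℝ} (hs : |s| ≤ 1) : Real.exp s ≤ 1 + s + 3 / 4 * s ^ 2 := by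
  have h := (abs_le.1 (Real.exp_bound hs (n := 3) (by norm_num))).2
  simp only [Finset.sum_range_succ, Finset.sum_range_zero, Nat.factorial] at h
  have h3 : |s| ^ 3 ≤ s ^ 2 := by
    rw [← sq_abs s]
    exact pow_le_pow_of_le_one (abs_nonneg s) hs (by norm_num)
  norm_num at h
  nlinarith [sq_nonneg s]

theorem abs_mul_inner_le (hy : ∀ i, y i = 1 ∨ y i = -1) (N : Seminorm ℝ (Vec d))
    (hN : ∀ v, N v = 0 → v = 0) (v : Vec d) (i : Fin n) :
    |y i * inner ℝ v (x i)| ≤ (⨆ i, dualNorm N (x i)) * N v := by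
  have h1 : |y i| = 1 := by rcases hy i with h | h <;> simp [h]
  rw [abs_mul, h1, one_mul, real_inner_comm]
  exact (abs_inner_le_dualNorm_mul N hN (x i) v).trans (mul_le_mul_of_nonneg_right
    (le_ciSup (f := fun i => dualNorm N (x i)) (Set.finite_range _).bddAbove i)
    (apply_nonneg N v))

theorem dualNorm_gradient_risk_le (hy : ∀ i, y i = 1 ∨ y i = -1) (N : Seminorm ℝ (Vec d))
    (hN : ∀ v, N v = 0 → v = 0) (w : Vec d) :
    dualNorm N (gradient (risk x y) w) ≤ (⨆ i, dualNorm N (x i)) * risk x y w := by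
  have hB : 0 ≤ ⨆ i, dualNorm N (x i) := Real.iSup_nonneg fun i => dualNorm_nonneg _ _
  refine dualNorm_le N fun v hv => ?_
  rw [inner_gradient_risk, abs_neg, abs_mul, abs_of_nonneg (by positivity : (0:ℝ) ≤ 1 / n), risk,
    mul_left_comm, Finset.mul_sum]
  refine mul_le_mul_of_nonneg_left ((Finset.abs_sum_le_sum_abs _ _).trans
    (Finset.sum_le_sum fun i _ => ?_)) (by positivity)
  rw [abs_mul, Real.abs_exp, mul_comm]
  exact mul_le_mul_of_nonneg_right ((abs_mul_inner_le x y hy N hN v i).trans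
    (mul_le_of_le_one_right hB hv)) (Real.exp_pos _).le

/-- The gradient domination that drives the implicit bias: a unit vector of margin `m` shows that
the dual norm of the gradient is at least `m` times the risk. -/
theorem margin_mul_risk_le_dualNorm [Nonempty (Fin n)] (N : Seminorm ℝ (Vec d))
    (hN : ∀ v, N v = 0 → v = 0) {v : Vec d} (hv : N v = 1) (w : Vec d) :
    margin x y v * risk x y w ≤ dualNorm N (gradient (risk x y) w) := by
  have h := (abs_le.1 (abs_inner_le_dualNorm_mul N hN (gradient (risk x y) w) v)).1
  rw [hv, mul_one, inner_gradient_risk] at h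
  refine le_trans ?_ (neg_le_neg_iff.1 h)
  rw [risk, mul_left_comm, Finset.mul_sum]
  refine mul_le_mul_of_nonneg_left (Finset.sum_le_sum fun i _ => ?_) (by positivity)
  rw [mul_comm]
  exact mul_le_mul_of_nonneg_left (margin_le x y v i) (Real.exp_pos _).le

/-- A quadratic upper bound whose curvature is proportional to the risk at the starting point. -/
theorem risk_add_smul_le (hy : ∀ i, y i = 1 ∨ y i = -1) (N : Seminorm ℝ (Vec d))
    (hN : ∀ v, N v = 0 → v = 0) (w v : Vec d)
    (hv : (⨆ i, dualNorm N (x i)) * N v ≤ 1) :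
    risk x y (w + v) ≤ risk x y w + inner ℝ (gradient (risk x y) w) v +
      3 / 4 * ((⨆ i, dualNorm N (x i)) * N v) ^ 2 * risk x y w := by
  set b := (⨆ i, dualNorm N (x i)) * N v with hb
  have hterm : ∀ i, Real.exp (-(y i * inner ℝ (w + v) (x i))) ≤
      Real.exp (-(y i * inner ℝ w (x i))) -
        Real.exp (-(y i * inner ℝ w (x i))) * (y i * inner ℝ v (x i)) +
        3 / 4 * b ^ 2 * Real.exp (-(y i * inner ℝ w (x i))) := fun i => by
    have habs := abs_mul_inner_le x y hy N hN v i
    have h1 := exp_le_one_add_add_sq (s := -(y i * inner ℝ v (x i)))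
      (by rw [abs_neg]; exact habs.trans hv)
    have h2 : (y i * inner ℝ v (x i)) ^ 2 ≤ b ^ 2 := by
      rw [← sq_abs]
      exact pow_le_pow_left₀ (abs_nonneg _) habs 2
    rw [inner_add_left, mul_add, neg_add, Real.exp_add]
    have h3 := mul_le_mul_of_nonneg_left
      (h1.trans (by linarith [neg_sq (y i * inner ℝ v (x i))] :
        _ ≤ 1 - y i * inner ℝ v (x i) + 3 / 4 * b ^ 2))
      (Real.exp_pos (-(y i * inner ℝ w (x i)))).le
    linarith
  have hsum := mul_le_mul_of_nonneg_left (Finset.sum_le_sum fun i (_ : i ∈ Finset.univ) => hterm i)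
    (by positivity : (0 : ℝ) ≤ 1 / n)
  rw [Finset.sum_add_distrib, Finset.sum_sub_distrib, ← Finset.mul_sum] at hsum
  rw [inner_gradient_risk]
  simp only [risk]
  linarith

end Risk

/-! ### Convergence of the normalized margin -/

section Dynamics

variable {n d : ℕ} [Nonempty (Fin n)] (x : Fin n → Vec d) (y : Fin n → ℝ)

/-- One step multiplies the risk by at most `exp (-γ m ‖∇L‖_*)`, up to an error that is controlled
by the decrease of the risk itself and hence telescopes. -/
theorem log_risk_step_le (hy : ∀ i, y i = 1 ∨ y i = -1) (N : Seminorm ℝ (Vec d))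
    (hN : ∀ v, N v = 0 → v = 0) {v₀ : Vec d} (hv₀ : N v₀ = 1) (hpos : 0 < margin x y v₀)
    {w Δ : Vec d} (hΔ : IsSteepestStep N (risk x y) w Δ) {γ γmax : ℝ} (hγ : 0 < γ)
    (hγmax : γ ≤ γmax) (hle : γ ≤ 1 / ((⨆ i, dualNorm N (x i)) ^ 2 * risk x y w)) :
    Real.log (risk x y (w + γ • Δ)) +
        3 * (⨆ i, dualNorm N (x i)) ^ 2 * γmax * risk x y (w + γ • Δ) +
        margin x y v₀ * (γ * dualNorm N (gradient (risk x y) w)) ≤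
      Real.log (risk x y w) + 3 * (⨆ i, dualNorm N (x i)) ^ 2 * γmax * risk x y w := by
  obtain ⟨hNΔ, hin⟩ := hΔ.norm_eq_and_inner_le N hN
  have hDle := dualNorm_gradient_risk_le x y hy N hN w
  have hDge := margin_mul_risk_le_dualNorm x y N hN hv₀ w
  have hL := risk_pos x y w
  have hL' := risk_pos x y (w + γ • Δ)
  set B := ⨆ i, dualNorm N (x i)
  set L := risk x y w
  set L' := risk x y (w + γ • Δ)
  set D := dualNorm N (gradient (risk x y) w)
  set m := margin x y v₀
  have hB0 : 0 ≤ B := Real.iSup_nonneg fun i => dualNorm_nonneg _ _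
  have hD : 0 < D := (mul_pos hpos hL).trans_le hDge
  have hγB : γ * (B ^ 2 * L) ≤ 1 := by
    rcases hB0.eq_or_lt with h | h
    · simp [← h]
    · exact (le_div_iff₀ (by positivity)).1 hle
  have hNv : N (γ • Δ) = γ * D := by rw [map_smul_eq_mul, Real.norm_of_nonneg hγ.le, hNΔ]
  have hstep := risk_add_smul_le x y hy N hN w (γ • Δ) (by
    rw [hNv]
    calc B * (γ * D) ≤ B * (γ * (B * L)) := by gcongr
      _ = γ * (B ^ 2 * L) := by ring
      _ ≤ 1 := hγB)
  rw [hNv, inner_smul_right] at hstep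
  have hstep' : L' ≤ L - γ * D ^ 2 + 3 / 4 * γ ^ 2 * B ^ 2 * D ^ 2 * L := by
    refine hstep.trans ?_
    have := mul_le_mul_of_nonneg_left hin hγ.le
    nlinarith
  have hdec : γ * D ^ 2 ≤ 4 * (L - L') := by
    have := mul_le_mul_of_nonneg_left hγB (by positivity : 0 ≤ γ * D ^ 2)
    nlinarith
  have hlog : Real.log L' ≤ Real.log L + (L' / L - 1) := by
    have := Real.log_le_sub_one_of_pos (div_pos hL' hL)
    rw [Real.log_div hL'.ne' hL.ne'] at this
    linarith
  have hratio : L' / L - 1 ≤ -(m * (γ * D)) + 3 / 4 * γ ^ 2 * B ^ 2 * D ^ 2 := by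
    rw [sub_le_iff_le_add, div_le_iff₀ hL]
    have := mul_le_mul_of_nonneg_left hDge (by positivity : 0 ≤ γ * D)
    nlinarith
  have herr : 3 / 4 * γ ^ 2 * B ^ 2 * D ^ 2 ≤ 3 * B ^ 2 * γmax * (L - L') := by
    have hγmax0 : 0 ≤ γmax := hγ.le.trans hγmax
    calc 3 / 4 * γ ^ 2 * B ^ 2 * D ^ 2 = 3 / 4 * B ^ 2 * γ * (γ * D ^ 2) := by ring
      _ ≤ 3 / 4 * B ^ 2 * γmax * (4 * (L - L')) := by gcongr
      _ = _ := by ring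
  linarith

theorem tendsto_normalized_margin (hy : ∀ i, y i = 1 ∨ y i = -1) (N : Seminorm ℝ (Vec d))
    (hN : ∀ v, N v = 0 → v = 0) {v₀ : Vec d} (hv₀ : N v₀ = 1) (hpos : 0 < margin x y v₀)
    (hmax : ∀ w, margin x y w ≤ margin x y v₀ * N w) {γ : ℕ → ℝ} {w : ℕ → Vec d}
    (hw : IsSteepestDescent N (risk x y) γ w) (hγ : AdmissibleSteps (dualNorm N) x y γ w) :
    (∀ᶠ t in atTop, 0 < N (w t)) ∧
      Tendsto (fun t => margin x y (w t) / N (w t)) atTop (𝓝 (margin x y v₀)) := by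
  obtain ⟨γmax, hγmax⟩ := hγ.bounded
  set m := margin x y v₀ with hm
  set K := 3 * (⨆ i, dualNorm N (x i)) ^ 2 * γmax with hK
  have hK0 : 0 ≤ K := by
    have : 0 ≤ γmax := (hγ.pos 0).le.trans (hγmax 0)
    positivity
  -- the length of the path up to time `T`
  set G : ℕ → ℝ := fun T =>
    ∑ t ∈ Finset.range T, γ t * dualNorm N (gradient (risk x y) (w t)) with hG
  have hGnn : ∀ T, 0 ≤ G T := fun T => Finset.sum_nonneg fun t _ =>
    mul_nonneg (hγ.pos t).le (dualNorm_nonneg _ _)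
  have hnorm : ∀ T, N (w T) ≤ N (w 0) + G T := fun T => by
    induction T with
    | zero => simp [hG]
    | succ T ih =>
      obtain ⟨Δ, hΔ, hstep⟩ := hw T
      have h1 := map_add_le_add N (w T) (γ T • Δ)
      rw [← hstep, map_smul_eq_mul, Real.norm_of_nonneg (hγ.pos T).le,
        (hΔ.norm_eq_and_inner_le N hN).1] at h1
      simp only [hG, Finset.sum_range_succ] at ih ⊢
      linarith
  have hlog : ∀ T, Real.log (risk x y (w T)) + K * risk x y (w T) + m * G T ≤
      Real.log (risk x y (w 0)) + K * risk x y (w 0) := fun T => by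
    induction T with
    | zero => simp [hG]
    | succ T ih =>
      obtain ⟨Δ, hΔ, hstep⟩ := hw T
      have h1 := log_risk_step_le x y hy N hN hv₀ hpos hΔ (hγ.pos T) (hγmax T) (hγ.le T)
      rw [← hstep] at h1
      simp only [hG, Finset.sum_range_succ, mul_add] at ih ⊢
      linarith
  obtain ⟨C, hC⟩ : ∃ C, ∀ T, m * G T - C ≤ margin x y (w T) := by
    refine ⟨Real.log n + (Real.log (risk x y (w 0)) + K * risk x y (w 0)), fun T => ?_⟩
    have hn : (0 : ℝ) < n := Nat.cast_pos.2 (Fin.pos_iff_nonempty.2 inferInstance)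
    have h1 := (Real.le_log_iff_exp_le (mul_pos hn (risk_pos x y (w T)))).2
      (exp_neg_margin_le x y (w T))
    rw [Real.log_mul hn.ne' (risk_pos x y (w T)).ne'] at h1
    have h2 := hlog T
    have h3 := mul_nonneg hK0 (risk_pos x y (w T)).le
    linarith
  have hGtop : Tendsto G atTop atTop := by
    have hmono : Monotone G := monotone_nat_of_le_succ fun T => by
      simp only [hG, Finset.sum_range_succ]
      exact le_add_of_nonneg_right (mul_nonneg (hγ.pos T).le (dualNorm_nonneg _ _))
    refine (tendsto_atTop_of_monotone hmono).resolve_right ?_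
    rintro ⟨l, hl⟩
    -- a bounded path stays where the risk, and hence the gradient, is bounded away from zero
    have hGl : ∀ T, G T ≤ l := hmono.ge_of_tendsto hl
    obtain ⟨c, hc, hcN⟩ := exists_pos_mul_norm_le N hN
    have hmem : ∀ T, w T ∈ Metric.closedBall (0 : Vec d) ((N (w 0) + l) / c) := fun T => by
      rw [mem_closedBall_zero_iff, le_div_iff₀ hc, mul_comm]
      linarith [hcN (w T), hnorm T, hGl T]
    obtain ⟨u, -, hu⟩ := (isCompact_closedBall (0 : Vec d) _).exists_isMinOn ⟨_, hmem 0⟩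
      (continuous_risk x y).continuousOn
    have ha : 0 < m * risk x y u := mul_pos hpos (risk_pos x y u)
    have hbig := hγ.sum_diverges.atTop_mul_const ha
    obtain ⟨T, hT⟩ := (hbig.eventually (eventually_gt_atTop l)).exists
    refine hT.not_ge (le_trans ?_ (hGl T))
    rw [Finset.sum_mul]
    refine Finset.sum_le_sum fun t _ => mul_le_mul_of_nonneg_left ?_ (hγ.pos t).le
    exact (mul_le_mul_of_nonneg_left (isMinOn_iff.1 hu _ (hmem t)) hpos.le).trans
      (margin_mul_risk_le_dualNorm x y N hN hv₀ (w t))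
  have hbigm : ∀ᶠ t in atTop, C < m * G t :=
    (hGtop.const_mul_atTop hpos).eventually (eventually_gt_atTop C)
  have hNpos : ∀ᶠ t in atTop, 0 < N (w t) := by
    filter_upwards [hbigm] with t ht
    have h1 : 0 < m * N (w t) := by linarith [hC t, hmax (w t)]
    exact (pos_iff_pos_of_mul_pos h1).1 hpos
  refine ⟨hNpos, ?_⟩
  have hlow : Tendsto (fun t => m - (m * N (w 0) + C) / (N (w 0) + G t)) atTop (𝓝 m) := by
    have := (tendsto_const_nhds (x := m)).sub
      ((tendsto_atTop_add_const_left _ (N (w 0)) hGtop).const_div_atTop (m * N (w 0) + C))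
    rwa [sub_zero] at this
  refine tendsto_of_tendsto_of_tendsto_of_le_of_le' hlow tendsto_const_nhds ?_ ?_
  · filter_upwards [hbigm, hNpos] with t h1 h2
    have h3 : 0 < N (w 0) + G t := h2.trans_le (hnorm t)
    calc m - (m * N (w 0) + C) / (N (w 0) + G t) = (m * G t - C) / (N (w 0) + G t) := by
          field_simp
          ring
      _ ≤ (m * G t - C) / N (w t) :=
          div_le_div_of_nonneg_left (by linarith) h2 (hnorm t)
      _ ≤ margin x y (w t) / N (w t) := div_le_div_of_nonneg_right (hC t) h2.le
  · filter_upwards [hNpos] with t ht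
    exact (div_le_iff₀ ht).2 (hmax (w t))

theorem IsSteepestDescent.reachesMaxRobust (hy : ∀ i, y i = 1 ∨ y i = -1) (hsep : Separable x y)
    (N : Seminorm ℝ (Vec d)) (hN : ∀ v, N v = 0 → v = 0) {γ : ℕ → ℝ} {w : ℕ → Vec d}
    (hw : IsSteepestDescent N (risk x y) γ w) (hγ : AdmissibleSteps (dualNorm N) x y γ w) :
    ReachesMaxRobust N (dualNorm N) x y w := by
  obtain ⟨v₀, hv₀, hpos, hmax⟩ := exists_max_margin x y hsep N hN
  obtain ⟨h1, h2⟩ := tendsto_normalized_margin x y hy N hN hv₀ hpos hmax hw hγ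
  exact reachesMaxRobust_of_tendsto x y hy N hN hv₀ hpos hmax h1 h2

end Dynamics

/-! ### The norms of index `1`, `2` and `∞` -/

section EllNorm

variable {d : ℕ}

/-- The norm `ellNorm p`, bundled as a seminorm. -/
noncomputable def ellSeminorm (d : ℕ) (p : ENNReal) [Fact (1 ≤ p)] : Seminorm ℝ (Vec d) :=
  (normSeminorm ℝ (PiLp p fun _ : Fin d => ℝ)).comp
    ((WithLp.linearEquiv 2 ℝ (Fin d → ℝ)).trans (WithLp.linearEquiv p ℝ (Fin d → ℝ)).symm).toLinearMap

theorem coe_ellSeminorm (p : ENNReal) [Fact (1 ≤ p)] : ⇑(ellSeminorm d p) = ellNorm p := rfl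

theorem ellSeminorm_eq_zero (p : ENNReal) [Fact (1 ≤ p)] (v : Vec d)
    (h : ellSeminorm d p v = 0) : v = 0 := by
  have h1 : (WithLp.toLp p (WithLp.ofLp v) : PiLp p fun _ : Fin d => ℝ) = 0 := norm_eq_zero.1 h
  ext j
  exact congrArg (fun u : PiLp p fun _ : Fin d => ℝ => u j) h1

theorem ellNorm_nonneg (p : ENNReal) [Fact (1 ≤ p)] (v : Vec d) : 0 ≤ ellNorm p v :=
  norm_nonneg _

theorem ellNorm_two (v : Vec d) : ellNorm 2 v = ‖v‖ := rfl

theorem ellNorm_one (v : Vec d) : ellNorm 1 v = ∑ j, |v j| :=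
  PiLp.norm_eq_of_L1 _

theorem ellNorm_top (v : Vec d) : ellNorm ⊤ v = ⨆ j, |v j| :=
  PiLp.norm_eq_ciSup _

theorem abs_le_ellNorm_top (v : Vec d) (j : Fin d) : |v j| ≤ ellNorm ⊤ v := by
  rw [ellNorm_top]
  exact le_ciSup (f := fun j => |v j|) (Set.finite_range _).bddAbove j

theorem inner_eq_sum (u v : Vec d) : inner ℝ u v = ∑ j, u j * v j := by
  simp [PiLp.inner_apply, mul_comm]

theorem abs_inner_le_ellNorm_one_mul_ellNorm_top (u v : Vec d) :
    |inner ℝ u v| ≤ ellNorm 1 u * ellNorm ⊤ v := by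
  rw [inner_eq_sum, ellNorm_one, Finset.sum_mul]
  refine (Finset.abs_sum_le_sum_abs _ _).trans (Finset.sum_le_sum fun j _ => ?_)
  rw [abs_mul]
  exact mul_le_mul_of_nonneg_left (abs_le_ellNorm_top v j) (abs_nonneg _)

theorem ellNorm_top_sign_le (g : Vec d) :
    ellNorm ⊤ (WithLp.toLp 2 (fun j => Real.sign (g j)) : Vec d) ≤ 1 := by
  rw [ellNorm_top]
  refine Real.iSup_le (fun j => ?_) zero_le_one
  rcases Real.sign_apply_eq (g j) with h | h | h <;> simp [h]

theorem sign_mul_self_eq_abs (a : ℝ) : Real.sign a * a = |a| := by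
  rcases lt_trichotomy a 0 with h | h | h
  · rw [Real.sign_of_neg h, abs_of_neg h, neg_one_mul]
  · simp [h]
  · rw [Real.sign_of_pos h, abs_of_pos h, one_mul]

theorem inner_sign (g : Vec d) :
    inner ℝ g (WithLp.toLp 2 (fun j => Real.sign (g j)) : Vec d) = ellNorm 1 g := by
  rw [inner_eq_sum, ellNorm_one]
  exact Finset.sum_congr rfl fun j _ => by
    rw [mul_comm]
    exact sign_mul_self_eq_abs _

theorem dualNorm_ellNorm_top : dualNorm (ellNorm (d := d) ⊤) = ellNorm 1 := by
  funext δ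
  exact dualNorm_eq_of_inner_eq (ellSeminorm d ⊤)
    (fun u => abs_inner_le_ellNorm_one_mul_ellNorm_top δ u) (ellNorm_nonneg 1 δ)
    (ellNorm_top_sign_le δ) (inner_sign δ)

theorem dualNorm_ellNorm_two : dualNorm (ellNorm (d := d) 2) = ellNorm 2 := by
  funext δ
  by_cases hδ : δ = 0
  · exact dualNorm_eq_of_inner_eq (ellSeminorm d 2) (v := 0)
      (fun u => abs_real_inner_le_norm δ u) (norm_nonneg δ) (by simp) (by simp [hδ, ellNorm_two])
  · have hδ' : ‖δ‖ ≠ 0 := norm_ne_zero_iff.2 hδ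
    refine dualNorm_eq_of_inner_eq (ellSeminorm d 2) (v := ‖δ‖⁻¹ • δ)
      (fun u => abs_real_inner_le_norm δ u) (norm_nonneg δ) ?_ ?_
    · rw [map_smul_eq_mul, coe_ellSeminorm, ellNorm_two, norm_inv, norm_norm,
        inv_mul_cancel₀ hδ']
    · rw [inner_smul_right, real_inner_self_eq_norm_sq, ellNorm_two]
      field_simp

theorem ellNorm_one_single (i : Fin d) (a : ℝ) :
    ellNorm 1 (EuclideanSpace.single i a : Vec d) = |a| := by
  rw [ellNorm_one, Finset.sum_eq_single i] <;> simp +contextual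

theorem ellNorm_top_eq_of_forall_le {g : Vec d} {i : Fin d} (hi : ∀ j, |g j| ≤ |g i|) :
    ellNorm ⊤ g = |g i| := by
  have : Nonempty (Fin d) := ⟨i⟩
  refine le_antisymm ?_ (abs_le_ellNorm_top g i)
  rw [ellNorm_top]
  exact ciSup_le hi

theorem dualNorm_ellNorm_one : dualNorm (ellNorm (d := d) 1) = ellNorm ⊤ := by
  funext δ
  have hle : ∀ u, |inner ℝ δ u| ≤ ellNorm ⊤ δ * ellSeminorm d 1 u := fun u => by
    rw [real_inner_comm, mul_comm]
    exact abs_inner_le_ellNorm_one_mul_ellNorm_top u δ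
  rcases isEmpty_or_nonempty (Fin d) with h | h
  · exact dualNorm_eq_of_inner_eq (ellSeminorm d 1) (v := 0) hle (ellNorm_nonneg ⊤ δ) (by simp)
      (by simp [ellNorm_top])
  · obtain ⟨i, hi⟩ := Finite.exists_max fun j => |δ j|
    refine dualNorm_eq_of_inner_eq (ellSeminorm d 1)
      (v := EuclideanSpace.single i (Real.sign (δ i))) hle (ellNorm_nonneg ⊤ δ) ?_ ?_
    · rw [coe_ellSeminorm, ellNorm_one_single]
      rcases Real.sign_apply_eq (δ i) with h | h | h <;> simp [h]
    · rw [EuclideanSpace.inner_single_right, ellNorm_top_eq_of_forall_le hi]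
      simp [sign_mul_self_eq_abs]

end EllNorm

/-! ### The three optimizers as steepest descent methods -/

section Methods

variable {d : ℕ} {f : Vec d → ℝ} {γ : ℕ → ℝ} {w : ℕ → Vec d}

theorem IsSignGradientDescent.isSteepestDescent (h : IsSignGradientDescent f γ w) :
    IsSteepestDescent (ellNorm ⊤) f γ w := by
  intro t
  refine ⟨-(ellNorm 1 (gradient f (w t)) •
    (WithLp.toLp 2 (fun j => Real.sign (gradient f (w t) j)) : Vec d)), ?_, ?_⟩
  · refine isSteepestStep_of_inner_eq (ellSeminorm d ⊤) (ellSeminorm_eq_zero ⊤) ?_ ?_ <;>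
      rw [coe_ellSeminorm, dualNorm_ellNorm_top]
    · rw [← coe_ellSeminorm, map_neg_eq_map, map_smul_eq_mul,
        Real.norm_of_nonneg (ellNorm_nonneg 1 _)]
      exact mul_le_of_le_one_right (ellNorm_nonneg 1 _) (ellNorm_top_sign_le _)
    · rw [inner_neg_right, inner_smul_right, inner_sign, sq]
  · rw [h t, smul_neg, smul_smul, sub_eq_add_neg]

theorem IsGradientDescent.isSteepestDescent (h : IsGradientDescent f γ w) :
    IsSteepestDescent (ellNorm 2) f γ w := by
  intro t
  refine ⟨-gradient f (w t), ?_, ?_⟩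
  · refine isSteepestStep_of_inner_eq (ellSeminorm d 2) (ellSeminorm_eq_zero 2) ?_ ?_ <;>
      rw [coe_ellSeminorm, dualNorm_ellNorm_two]
    · rw [ellNorm_two, ellNorm_two, norm_neg]
    · rw [inner_neg_right, real_inner_self_eq_norm_sq, ellNorm_two]
  · rw [h t, smul_neg, sub_eq_add_neg]

theorem IsCoordinateDescent.isSteepestDescent (h : IsCoordinateDescent f γ w) :
    IsSteepestDescent (ellNorm 1) f γ w := by
  intro t
  obtain ⟨i, hi, hstep⟩ := h t
  refine ⟨-(gradient f (w t) i • EuclideanSpace.single i (1 : ℝ)), ?_, ?_⟩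
  · refine isSteepestStep_of_inner_eq (ellSeminorm d 1) (ellSeminorm_eq_zero 1) ?_ ?_ <;>
      rw [coe_ellSeminorm, dualNorm_ellNorm_one, ellNorm_top_eq_of_forall_le hi]
    · rw [← coe_ellSeminorm, map_neg_eq_map, map_smul_eq_mul, coe_ellSeminorm, ellNorm_one_single]
      simp
    · rw [inner_neg_right, inner_smul_right, EuclideanSpace.inner_single_right, sq_abs]
      simp [sq]
  · rw [hstep, smul_neg, smul_smul, sub_eq_add_neg]

/-- By strict convexity of the Euclidean norm, the maximally robust direction is unique. -/
theorem maxRobustDirections_ellNorm_two_subsingleton {n : ℕ} [Nonempty (Fin n)]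
    (x : Fin n → Vec d) (y : Fin n → ℝ) (hy : ∀ i, y i = 1 ∨ y i = -1) (hsep : Separable x y) :
    (maxRobustDirections (ellNorm 2) (ellNorm 2) x y).Subsingleton := by
  have hN := ellSeminorm_eq_zero (d := d) 2
  obtain ⟨v₀, hv₀, hpos, hmax⟩ := exists_max_margin x y hsep (ellSeminorm d 2) hN
  have hS := maxRobustDirections_eq x y hy (ellSeminorm d 2) hN hv₀ hpos hmax
  rw [coe_ellSeminorm, dualNorm_ellNorm_two] at hS
  rw [hS]
  rintro u ⟨hu, hum⟩ v ⟨hv, hvm⟩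
  by_contra hne
  have hu1 : ‖u‖ = 1 := hu
  have hv1 : ‖v‖ = 1 := hv
  -- the margin of `u + v` is at least twice the maximum, while its norm is less than two
  have h1 : ‖u + v‖ < 2 := by
    have := norm_add_lt_of_not_sameRay (x := u) (y := v) fun h =>
      hne ((sameRay_iff_of_norm_eq (hu1.trans hv1.symm)).1 h)
    rw [hu1, hv1] at this
    linarith
  have h2 := (add_margin_le x y u v).trans (hmax (u + v))
  rw [coe_ellSeminorm, ellNorm_two, hum, hvm] at h2
  nlinarith

end Methods

end ImplicitBias

open ImplicitBias
theorem corollary1 {n d : ℕ} (hn : 0 < n) (x : Fin n → Vec d) (y : Fin n → ℝ)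
    (hy : ∀ i, y i = 1 ∨ y i = -1) (hsep : Separable x y) :
    -- steepest descent with respect to an arbitrary norm, attacks bounded in the dual norm
    (∀ N : Seminorm ℝ (Vec d), (∀ v, N v = 0 → v = 0) →
      ∀ (γ : ℕ → ℝ) (w : ℕ → Vec d), IsSteepestDescent N (risk x y) γ w →
        AdmissibleSteps (dualNorm N) x y γ w → ReachesMaxRobust N (dualNorm N) x y w) ∧
    -- sign gradient descent, attacks bounded in the norm of index 1
    (∀ (γ : ℕ → ℝ) (w : ℕ → Vec d), IsSignGradientDescent (risk x y) γ w →
        AdmissibleSteps (ellNorm 1) x y γ w → ReachesMaxRobust (ellNorm ⊤) (ellNorm 1) x y w) ∧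
    -- gradient descent, attacks bounded in the norm of index 2
    (∀ (γ : ℕ → ℝ) (w : ℕ → Vec d), IsGradientDescent (risk x y) γ w →
        AdmissibleSteps (ellNorm 2) x y γ w → ReachesMaxRobust (ellNorm 2) (ellNorm 2) x y w ∧
          ∃ v, MaximallyRobust (ellNorm 2) x y v ∧ ConvergesInDirection (ellNorm 2) w v) ∧
    -- coordinate descent, attacks bounded in the norm of index infinity
    (∀ (γ : ℕ → ℝ) (w : ℕ → Vec d), IsCoordinateDescent (risk x y) γ w →
        AdmissibleSteps (ellNorm ⊤) x y γ w → ReachesMaxRobust (ellNorm 1) (ellNorm ⊤) x y w) := by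
  have : Nonempty (Fin n) := ⟨⟨0, hn⟩⟩
  have hmain := fun (N : Seminorm ℝ (Vec d)) (hN : ∀ v, N v = 0 → v = 0) (γ : ℕ → ℝ)
    (w : ℕ → Vec d) (hw : IsSteepestDescent N (risk x y) γ w)
    (hγ : AdmissibleSteps (dualNorm N) x y γ w) => hw.reachesMaxRobust x y hy hsep N hN hγ
  refine ⟨hmain, fun γ w hw hγ => ?_, fun γ w hw hγ => ?_, fun γ w hw hγ => ?_⟩
  · rw [← dualNorm_ellNorm_top] at hγ ⊢
    exact hmain (ellSeminorm d ⊤) (ellSeminorm_eq_zero ⊤) γ w hw.isSteepestDescent hγ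
  · have hreach : ReachesMaxRobust (ellNorm 2) (ellNorm 2) x y w := by
      have h := hmain (ellSeminorm d 2) (ellSeminorm_eq_zero 2) γ w hw.isSteepestDescent
      rw [coe_ellSeminorm, dualNorm_ellNorm_two] at h
      exact h hγ
    obtain ⟨v, hv⟩ := hreach.nonempty
    exact ⟨hreach, v, hv.2, hreach.unique v
      ((maxRobustDirections_ellNorm_two_subsingleton x y hy hsep).eq_singleton_of_mem hv)⟩
  · rw [← dualNorm_ellNorm_one] at hγ ⊢
    exact hmain (ellSeminorm d 1) (ellSeminorm_eq_zero 1) γ w hw.isSteepestDescent hγ
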